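/- Let $n\ge 1$ and let $X$ be a metrizable ANR, i.e. a metrizable space such that every continuous map into $X$ from a closed subset of a metrizable space extends continuously to a neighborhood of that subset. Let $S_nX$ be the space of nullhomotopic continuous maps $S^n\to X$ with the compact-open topology, $c_n(X)\subset S_nX$ the set of constant maps, and let $O(n+1)$ act on $S_nX$ by $(g\cdot\gamma)(p)=\gamma(g^{-1}p)$. Let $r_n:C^0(B^{n+1},X)\to S_nX$, $r_n(u)=u|_{S^n}$. For $A\subset S_nX$ let $\mathsf{SC}_{n,X}(A)\in\mathbb{N}_0\cup\{+\infty\}$ be the least $k$ such that $A$ is covered by $k$ relatively open subsets over each of which $r_n$ has a continuous local section (so $\mathsf{SC}_{n,X}(\varnothing)=0$). Let $G\subset O(n+1)$ be a closed subgroup, $A\subset S_nX$ a $G$-invariant subset with $c_n(X)\subset A$, $F:A\to\mathbb{R}$ continuous and $\varphi:A\to A$ a homotopy equivalence. Assume that $(G,A,F,\varphi)$ is admissible, i.e. (i) $F$ is $G$-invariant and $\mathrm{Fix}\,\varphi$ is a $G$-invariant set; (ii) $F$ is constant on $c_n(X)$; (iii) $(F,\varphi)$ satisfies condition (D) on $A$: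 $F(\varphi(x))<F(x)$ whenever $\varphi(x)\ne x$; and if $F$ is bounded on a set $B\subset A$ but $\{F(y)-F(\varphi(y)) : y\in B\}$ is not bounded away from zero, then the closure of $B$ in $A$ meets $\mathrm{Fix}\,\varphi$; (iv) every point of $F(\mathrm{Fix}\,\varphi)$ is isolated in $F(\mathrm{Fix}\,\varphi)$. Assume moreover that $F$ is bounded from below. For $\lambda\in\mathbb{R}$ put $F^\lambda=F^{-1}((-\infty,\lambda])$, and let $\nu(\varphi,F,\lambda)$ and $\nu(\varphi)$ in $\mathbb{N}_0\cup\{+\infty\}$ be the numbers of $G$-orbits of non-constant elements of $\mathrm{Fix}\,\varphi\cap F^\lambda$ and of $\mathrm{Fix}\,\varphi$, respectively. (a) Assume that $\mathsf{SC}_{n,X}(\varphi(B))\ge\mathsf{SC}_{n,X}(B)$ for every subset $B\subset A$ that is closed in $A$. If $\lambda\in\mathbb{R}$ and every non-constant element of $\mathrm{Fix}\,\varphi\cap F^\lambda$ has trivial $G$-isotropy group, then $$\nu(\varphi,F,\lambda)\ \ge\ \mathsf{SC}_{n,X}(F^\lambda)-1.$$ (b) If $\varphi$ is homotopic to $\mathrm{id}_A$,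 $F(\mathrm{Fix}\,\varphi)$ is finite, and every non-constant element of $\mathrm{Fix}\,\varphi$ has trivial $G$-isotropy group, then $$\nu(\varphi)\ \ge\ \mathsf{SC}_{n,X}(A)-1.$$ -/

import Mathlib

open Set Topology

universe u

/-- A topological space `X` is a metrizable absolute neighborhood retract (ANR): it is metrizable
and every continuous map into `X` from a closed subset of a metrizable space extends continuously
to an open neighborhood of that closed subset. -/
def IsMetrizableANR (X : Type u) [TopologicalSpace X] : Prop :=
  TopologicalSpace.MetrizableSpace X ∧
    ∀ (Y : Type u) [TopologicalSpace Y] [TopologicalSpace.MetrizableSpace Y] (C : Set Y),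
      IsClosed C → ∀ f : C(C, X), ∃ U : Set Y, IsOpen U ∧ ∃ hCU : C ⊆ U, ∃ g : C(U, X),
        ∀ c : C, g (Set.inclusion hCU c) = f c

/-- The sectional category of a continuous map `p : E → B`: the least number of open sets covering
`B` over each of which `p` has a continuous local section (`⊤` if there is no finite such cover).
It is `0` when `B` is empty. -/
noncomputable def secat {E B : Type*} [TopologicalSpace E] [TopologicalSpace B] (p : E → B) : ℕ∞ :=
  sInf {m : ℕ∞ | ∃ k : ℕ, m = (k : ℕ∞) ∧ ∃ U : Fin k → Set B, (∀ i, IsOpen (U i)) ∧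
    (⋃ i, U i) = Set.univ ∧ ∀ i, ∃ s : U i → E, Continuous s ∧ ∀ b : U i, p (s b) = (b : B)}

/-- `(f, φ)` satisfies condition (D) on the space `Y`. -/
structure ConditionD {Y : Type*} [TopologicalSpace Y] (f : Y → ℝ) (φ : Y → Y) : Prop where
  /-- `f` strictly decreases along `φ` away from the fixed points. -/
  decreasing : ∀ y : Y, φ y ≠ y → f (φ y) < f y
  /-- If `f` is bounded on `B` but `f - f ∘ φ` is not bounded away from zero on `B`, then
  the closure of `B` contains a fixed point. -/
  compactness : ∀ B : Set Y, (∃ M : ℝ, ∀ y ∈ B, |f y| ≤ M) →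
    (¬ ∃ δ : ℝ, 0 < δ ∧ ∀ y ∈ B, δ ≤ |f y - f (φ y)|) →
    (closure B ∩ Function.fixedPoints φ).Nonempty

/-- The unit sphere `S^n` in `ℝ^{n+1}`. -/
abbrev USphere (n : ℕ) : Type := Metric.sphere (0 : EuclideanSpace ℝ (Fin (n + 1))) 1

/-- The closed unit ball `B^{n+1}` in `ℝ^{n+1}`. -/
abbrev UBall (n : ℕ) : Type := Metric.closedBall (0 : EuclideanSpace ℝ (Fin (n + 1))) 1

/-- The orthogonal group `O(n+1)`. -/
abbrev OGroup (n : ℕ) : Type := Matrix.orthogonalGroup (Fin (n + 1)) ℝ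

/-- `S_n X`: the nullhomotopic continuous maps `S^n → X`, with the (subspace topology of the)
compact-open topology. -/
abbrev SphereSpace (n : ℕ) (X : Type u) [TopologicalSpace X] : Type u :=
  {γ : C(USphere n, X) // γ.Nullhomotopic}

/-- The inclusion of the sphere into the ball. -/
def sphereIncl (n : ℕ) : C(USphere n, UBall n) :=
  ⟨Set.inclusion Metric.sphere_subset_closedBall, continuous_inclusion _⟩

instance uBall_contractible (n : ℕ) : ContractibleSpace (UBall n) :=
  (convex_closedBall _ _).contractibleSpace ⟨0, by simp⟩

theorem nullhomotopic_comp_sphereIncl {n : ℕ} {X : Type u} [TopologicalSpace X]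
    (β : C(UBall n, X)) : (β.comp (sphereIncl n)).Nullhomotopic :=
  ((id_nullhomotopic (UBall n)).comp_right β).comp_left (sphereIncl n)

/-- The restriction map `r_n : B_{n+1} X → S_n X`, where `B_{n+1} X = C(B^{n+1}, X)`. -/
def sphereRestrict (n : ℕ) (X : Type u) [TopologicalSpace X] (β : C(UBall n, X)) :
    SphereSpace n X :=
  ⟨β.comp (sphereIncl n), nullhomotopic_comp_sphereIncl β⟩

/-- The subspace spherical complexity `SC_{n,X}(A)` of `A ⊆ S_n X`: the sectional category of
the restriction `r_n⁻¹(A) → A` of `r_n`. -/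
noncomputable def sphericalComplexity (n : ℕ) (X : Type u) [TopologicalSpace X]
    (A : Set (SphereSpace n X)) : ℕ∞ :=
  secat (A.restrictPreimage (sphereRestrict n X))

/-- The set `c_n(X) ⊆ S_n X` of constant maps. -/
def constMaps (n : ℕ) (X : Type u) [TopologicalSpace X] : Set (SphereSpace n X) :=
  {γ | ∃ x : X, γ.1 = ContinuousMap.const (USphere n) x}

theorem orthogonal_mulVec_mem_sphere {n : ℕ} (g : OGroup n) (p : USphere n) :
    WithLp.toLp 2 (g.1.mulVec p.1.ofLp) ∈
      Metric.sphere (0 : EuclideanSpace ℝ (Fin (n + 1))) 1 := by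
  have hp : p.1.ofLp ⬝ᵥ p.1.ofLp = 1 := by
    have h : ‖p.1‖ = 1 := by simp
    have h2 := real_inner_self_eq_norm_sq p.1
    rw [h, EuclideanSpace.inner_eq_star_dotProduct, star_trivial] at h2
    simpa only [one_pow] using h2
  have hg : g.1.transpose * g.1 = 1 := by
    simpa using (Matrix.mem_orthogonalGroup_iff' (Fin (n + 1)) ℝ).1 g.2
  rw [mem_sphere_zero_iff_norm, ← sq_eq_sq₀ (norm_nonneg _) zero_le_one,
    ← real_inner_self_eq_norm_sq]
  simp only [EuclideanSpace.inner_eq_star_dotProduct, star_trivial]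
  rw [Matrix.dotProduct_mulVec, Matrix.vecMul_mulVec, hg, Matrix.vecMul_one, hp]
  norm_num

/-- The standard action of `g ∈ O(n+1)` on the unit sphere, `p ↦ g p`. -/
def rotateSphere {n : ℕ} (g : OGroup n) : C(USphere n, USphere n) where
  toFun p := ⟨WithLp.toLp 2 (g.1.mulVec p.1.ofLp), orthogonal_mulVec_mem_sphere g p⟩
  continuous_toFun := by
    refine Continuous.subtype_mk ?_ _
    fun_prop

theorem rotateSphere_one {n : ℕ} : rotateSphere (1 : OGroup n) = ContinuousMap.id _ := by
  ext p i
  simp [rotateSphere]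

theorem rotateSphere_mul {n : ℕ} (g h : OGroup n) :
    rotateSphere (g * h) = (rotateSphere g).comp (rotateSphere h) := by
  ext p i
  simp [rotateSphere, Matrix.mulVec_mulVec]

/-- The left action of `O(n+1)` on `S_n X`, `(g • γ)(p) = γ(g⁻¹ p)`. -/
instance sphereSpaceAction (n : ℕ) (X : Type u) [TopologicalSpace X] :
    MulAction (OGroup n) (SphereSpace n X) where
  smul g γ := ⟨γ.1.comp (rotateSphere g⁻¹), γ.2.comp_left _⟩
  one_smul γ := by
    apply Subtype.ext
    change γ.1.comp (rotateSphere (1 : OGroup n)⁻¹) = γ.1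
    rw [inv_one, rotateSphere_one, ContinuousMap.comp_id]
  mul_smul g h γ := by
    apply Subtype.ext
    change γ.1.comp (rotateSphere (g * h)⁻¹) =
      (γ.1.comp (rotateSphere h⁻¹)).comp (rotateSphere g⁻¹)
    rw [mul_inv_rev, rotateSphere_mul, ContinuousMap.comp_assoc]

/-- `(G, A, F, φ)` is an admissible quadruple. The first four fields are the setting in which
admissibility is considered, the remaining ones are the defining conditions. -/
structure IsAdmissible {n : ℕ} {X : Type u} [TopologicalSpace X] (G : Subgroup (OGroup n))
    (A : Set (SphereSpace n X)) (F : C(A, ℝ)) (φ : C(A, A)) : Prop where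
  isClosed_group : IsClosed (G : Set (OGroup n))
  invariant : ∀ g ∈ G, ∀ γ ∈ A, g • γ ∈ A
  constMaps_subset : constMaps n X ⊆ A
  homotopyEquiv : ∃ e : ContinuousMap.HomotopyEquiv A A, e.toFun = φ
  F_invariant : ∀ g ∈ G, ∀ a b : A, (b : SphereSpace n X) = g • (a : SphereSpace n X) → F b = F a
  fix_invariant : ∀ g ∈ G, ∀ a b : A, (b : SphereSpace n X) = g • (a : SphereSpace n X) →
    φ a = a → φ b = b
  F_const : ∀ a b : A, (a : SphereSpace n X) ∈ constMaps n X →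
    (b : SphereSpace n X) ∈ constMaps n X → F a = F b
  conditionD : ConditionD F φ
  isolated : ∀ v ∈ F '' Function.fixedPoints φ, ∃ ε : ℝ, 0 < ε ∧
    ∀ w ∈ F '' Function.fixedPoints φ, |w - v| < ε → w = v

/-- The closed sublevel set `F^c` of a function `F` on `A ⊆ S_n X`, as a subset of `S_n X`. -/
def sublevelSet {n : ℕ} {X : Type u} [TopologicalSpace X] {A : Set (SphereSpace n X)}
    (F : A → ℝ) (c : ℝ) : Set (SphereSpace n X) :=
  Subtype.val '' {a : A | F a ≤ c}

/-- The fixed points of `φ : A → A`, as a subset of `S_n X`. -/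
def fixSet {n : ℕ} {X : Type u} [TopologicalSpace X] {A : Set (SphereSpace n X)}
    (φ : A → A) : Set (SphereSpace n X) :=
  Subtype.val '' Function.fixedPoints φ

/-- The number (in `ℕ ∪ {∞}`) of `G`-orbits of non-constant elements of a set `S ⊆ S_n X`. -/
noncomputable def numNonconstOrbits {n : ℕ} {X : Type u} [TopologicalSpace X]
    (G : Subgroup (OGroup n)) (S : Set (SphereSpace n X)) : ℕ∞ :=
  ((fun γ : SphereSpace n X => MulAction.orbit G γ) '' (S \ constMaps n X)).encard

/-! This is a Lusternik–Schnirelmann argument with iteration of `φ` in place of a gradient flow; the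
index of a set is the number of relatively open pieces needed to fill its spheres continuously. The
ANR property extends fillings from closed sets to open neighbourhoods (`HasFilling.exists_isOpen`),
so on closed sets the index is subadditive and unchanged on a small neighbourhood.

By (D), outside a neighbourhood of the fixed points at a level, `φ` lowers `F` by a uniform amount.
Since the index does not drop under `φ`, crossing that level costs at most the index of those fixed
points (`FillCover.cross_critical_level`), and a range of levels without fixed points costs nothing.
Starting from an empty sublevel set, the costs add up. The constant maps cost one, being filled by
constants; a free orbit costs one, since it is a copy of `G` along which a single filling can be
rotated (`hasFilling_orbit`).

For (b), a homotopy from the identity to `φ` glues onto fillings as a collar (`FillCover.of_image`),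
which gives the monotonicity assumed in (a). All fixed points lie below some level, and
`ConditionD.exists_homotopic_le` deforms `A` below it. -/

/-! ### Fillings and covers by fillable sets -/

section FillCover

variable {n : ℕ} {X : Type u} [TopologicalSpace X]
  {T T' : Type*} [TopologicalSpace T] [TopologicalSpace T']

/-- The family of spheres `ι` admits a continuous family of fillings over `V`. -/
def HasFilling (ι : T → SphereSpace n X) (V : Set T) : Prop :=
  ∃ s : V → C(UBall n, X), Continuous s ∧ ∀ v : V, sphereRestrict n X (s v) = ι v

/-- The set `B` is covered by `k` relatively open sets over each of which `ι` can be filled. -/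
def FillCover (ι : T → SphereSpace n X) (B : Set T) (k : ℕ) : Prop :=
  ∃ U : Fin k → Set T, (∀ i, IsOpen (U i)) ∧ B ⊆ ⋃ i, U i ∧ ∀ i, HasFilling ι (B ∩ U i)

theorem HasFilling.comp {ι : T → SphereSpace n X} {ι' : T' → SphereSpace n X} {V : Set T}
    {V' : Set T'} (h : HasFilling ι V) {f : T' → T} (hf : ContinuousOn f V')
    (hV : MapsTo f V' V) (hι : ∀ v ∈ V', ι (f v) = ι' v) : HasFilling ι' V' := by
  obtain ⟨s, hs, hsι⟩ := h
  refine ⟨fun v => s ⟨f v, hV v.2⟩, hs.comp ?_, fun v => ?_⟩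
  · exact Continuous.subtype_mk (continuousOn_iff_continuous_domRestrict.1 hf) _
  · rw [hsι, hι v v.2]

theorem HasFilling.mono {ι : T → SphereSpace n X} {V V' : Set T} (h : HasFilling ι V)
    (hV : V' ⊆ V) : HasFilling ι V' :=
  h.comp (f := id) continuousOn_id hV fun _ _ => rfl

theorem HasFilling.empty (ι : T → SphereSpace n X) : HasFilling ι ∅ :=
  ⟨fun v => v.2.elim, continuous_of_const fun v => v.2.elim, fun v => v.2.elim⟩

theorem FillCover.mono {ι : T → SphereSpace n X} {B B' : Set T} {k : ℕ} (h : FillCover ι B k)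
    (hB : B' ⊆ B) : FillCover ι B' k := by
  obtain ⟨U, hU, hBU, hs⟩ := h
  exact ⟨U, hU, hB.trans hBU, fun i => (hs i).mono (inter_subset_inter_left _ hB)⟩

theorem FillCover.mono_right {ι : T → SphereSpace n X} {B : Set T} {k l : ℕ}
    (h : FillCover ι B k) (hkl : k ≤ l) : FillCover ι B l := by
  obtain ⟨U, hU, hBU, hs⟩ := h
  refine ⟨fun i => if hi : i.1 < k then U ⟨i, hi⟩ else ∅, fun i => ?_, fun b hb => ?_,
    fun i => ?_⟩
  · dsimp only
    split_ifs
    · exact hU _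
    · exact isOpen_empty
  · obtain ⟨i, hi⟩ := mem_iUnion.1 (hBU hb)
    exact mem_iUnion.2 ⟨⟨i, i.2.trans_le hkl⟩, by simpa using hi⟩
  · dsimp only
    split_ifs
    · exact hs _
    · rw [inter_empty]; exact HasFilling.empty ι

theorem FillCover.empty (ι : T → SphereSpace n X) (k : ℕ) : FillCover ι ∅ k :=
  ⟨fun _ => ∅, fun _ => isOpen_empty, empty_subset _, fun _ => by
    rw [inter_empty]; exact HasFilling.empty ι⟩

theorem HasFilling.fillCover {ι : T → SphereSpace n X} {B : Set T} (h : HasFilling ι B) :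
    FillCover ι B 1 :=
  ⟨fun _ => univ, fun _ => isOpen_univ, fun _ _ => mem_iUnion.2 ⟨0, trivial⟩, fun _ =>
    h.mono inter_subset_left⟩

theorem secat_le_iff {E B : Type*} [TopologicalSpace E] [TopologicalSpace B] (p : E → B) (k : ℕ) :
    secat p ≤ k ↔ ∃ l ≤ k, ∃ U : Fin l → Set B, (∀ i, IsOpen (U i)) ∧
      (⋃ i, U i) = Set.univ ∧ ∀ i, ∃ s : U i → E, Continuous s ∧ ∀ b : U i, p (s b) = (b : B) := by
  constructor
  · intro h
    have hne : {m : ℕ∞ | ∃ k : ℕ, m = (k : ℕ∞) ∧ ∃ U : Fin k → Set B, (∀ i, IsOpen (U i)) ∧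
      (⋃ i, U i) = Set.univ ∧
        ∀ i, ∃ s : U i → E, Continuous s ∧ ∀ b : U i, p (s b) = (b : B)}.Nonempty := by
      by_contra hne
      rw [not_nonempty_iff_eq_empty] at hne
      rw [secat, hne, sInf_empty] at h
      exact ENat.natCast_ne_top k (top_le_iff.1 h)
    obtain ⟨l, hl, hU⟩ := csInf_mem hne
    refine ⟨l, ?_, hU⟩
    have h' : (l : ℕ∞) ≤ k := hl ▸ h
    exact_mod_cast h'
  · rintro ⟨l, hl, hU⟩
    have h : secat p ≤ l := sInf_le ⟨l, rfl, hU⟩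
    exact h.trans (by exact_mod_cast hl)

/-- Relatively open sets are traces of open sets, and a cover by fewer than `k` sets is padded with
empty ones. Hence everything below can take place inside the one space `A`. -/
theorem sphericalComplexity_image_le_iff {A : Set (SphereSpace n X)} (B : Set A) (k : ℕ) :
    sphericalComplexity n X (Subtype.val '' B) ≤ k ↔
      FillCover (Subtype.val : A → SphereSpace n X) B k := by
  rw [sphericalComplexity, secat_le_iff]
  constructor
  · rintro ⟨l, hl, U, hU, hcov, hs⟩
    refine FillCover.mono_right ?_ hl
    have hO : ∀ i, ∃ O : Set (SphereSpace n X), IsOpen O ∧ Subtype.val ⁻¹' O = U i :=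
      fun i => isOpen_induced_iff.1 (hU i)
    choose O hO hOU using hO
    have key : ∀ i (b : A) (hb : b ∈ B), b.1 ∈ O i →
        (⟨b.1, mem_image_of_mem _ hb⟩ : (Subtype.val '' B : Set (SphereSpace n X))) ∈ U i := by
      intro i b hb hbO
      rw [← hOU i]; exact hbO
    refine ⟨fun i => Subtype.val ⁻¹' O i, fun i => (hO i).preimage continuous_subtype_val,
      fun b hb => ?_, fun i => ?_⟩
    · have := hcov.ge (mem_univ ⟨b.1, mem_image_of_mem _ hb⟩)
      obtain ⟨i, hi⟩ := mem_iUnion.1 this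
      rw [← hOU i] at hi
      exact mem_iUnion.2 ⟨i, hi⟩
    · obtain ⟨s, hs, hsb⟩ := hs i
      refine ⟨fun v => (s ⟨_, key i v.1 v.2.1 v.2.2⟩).1,
        continuous_subtype_val.comp (hs.comp ?_), fun v => ?_⟩
      · fun_prop
      · exact congrArg Subtype.val (hsb ⟨_, key i v.1 v.2.1 v.2.2⟩)
  · rintro ⟨U, hU, hcov, hs⟩
    refine ⟨k, le_rfl, ?_⟩
    have hO : ∀ i, ∃ O : Set (SphereSpace n X), IsOpen O ∧ Subtype.val ⁻¹' O = U i :=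
      fun i => isOpen_induced_iff.1 (hU i)
    choose O hO hOU using hO
    have hA : ∀ b ∈ (Subtype.val '' B : Set (SphereSpace n X)), b ∈ A := by
      rintro _ ⟨a, -, rfl⟩; exact a.2
    have hB : ∀ b (hb : b ∈ (Subtype.val '' B : Set (SphereSpace n X))), ⟨b, hA b hb⟩ ∈ B := by
      rintro _ ⟨a, ha, rfl⟩; exact ha
    refine ⟨fun i => Subtype.val ⁻¹' O i, fun i => (hO i).preimage continuous_subtype_val,
      eq_univ_of_forall fun b => ?_, fun i => ?_⟩
    · obtain ⟨i, hi⟩ := mem_iUnion.1 (hcov (hB _ b.2))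
      rw [← hOU i] at hi
      exact mem_iUnion.2 ⟨i, hi⟩
    · obtain ⟨s, hs, hsb⟩ := hs i
      have hmem : ∀ v : (Subtype.val ⁻¹' O i : Set (Subtype.val '' B : Set (SphereSpace n X))),
          (⟨v.1.1, hA _ v.1.2⟩ : A) ∈ B ∩ U i := fun v =>
        ⟨hB _ v.1.2, by rw [← hOU i]; exact v.2⟩
      have hpre : ∀ v, s ⟨_, hmem v⟩ ∈ sphereRestrict n X ⁻¹' (Subtype.val '' B) := fun v => by
        rw [mem_preimage, hsb]; exact v.1.2
      refine ⟨fun v => ⟨s ⟨_, hmem v⟩, hpre v⟩, Continuous.subtype_mk ?_ hpre, fun v => ?_⟩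
      · exact hs.comp (f := fun v => (⟨_, hmem v⟩ : ↥(B ∩ U i))) (by fun_prop)
      · apply Subtype.ext
        exact hsb ⟨_, hmem v⟩

end FillCover

/-! ### Extending fillings from closed sets -/

section Extension

variable {n : ℕ} {X : Type u} [TopologicalSpace X] {T : Type u} [TopologicalSpace T]

theorem isClosed_sphere_in_ball (n : ℕ) : IsClosed {p : UBall n | ‖p.1‖ = 1} :=
  isClosed_eq (by fun_prop) continuous_const

/-- A filling over `C`, together with the spheres over all of `T`, is one continuous map on the
closed set `C × B ∪ T × S` of `T × B`. The ANR property extends it to an open set, which contains `W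
× B` for some open `W ⊇ C` because the ball is compact. -/
theorem HasFilling.exists_isOpen [TopologicalSpace.MetrizableSpace T] (hX : IsMetrizableANR X)
    {ι : T → SphereSpace n X} (hι : Continuous ι) {C : Set T} (hC : IsClosed C)
    (h : HasFilling ι C) : ∃ W, IsOpen W ∧ C ⊆ W ∧ HasFilling ι W := by
  classical
  obtain ⟨s, hs, hsι⟩ := h
  by_cases hT : IsEmpty T
  · exact ⟨∅, isOpen_empty, fun c => hT.elim c, HasFilling.empty ι⟩
  rw [not_isEmpty_iff] at hT
  have hsph : ∀ p : UBall n, ‖p.1‖ = 1 → p.1 ∈ Metric.sphere (0 : EuclideanSpace ℝ (Fin (n + 1))) 1 :=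
    fun p hp => by simpa using hp
  let D₁ : Set (T × UBall n) := {y | y.1 ∈ C}
  let D₂ : Set (T × UBall n) := {y | ‖y.2.1‖ = 1}
  have hD₁ : IsClosed D₁ := hC.preimage continuous_fst
  have hD₂ : IsClosed D₂ := (isClosed_sphere_in_ball n).preimage continuous_snd
  obtain ⟨p₀⟩ : Nonempty (USphere n) := (NormedSpace.sphere_nonempty.2 zero_le_one).to_subtype
  let x₀ : X := (ι hT.some).1 p₀
  -- The value `x₀` is a filler off `D₁ ∪ D₂`; on `D₁ ∩ D₂` the two branches agree because `s` fills
  -- `ι`.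
  let f : T × UBall n → X := fun y =>
    if h : y.1 ∈ C then s ⟨y.1, h⟩ y.2 else
      if h : ‖y.2.1‖ = 1 then (ι y.1).1 ⟨y.2.1, hsph _ h⟩ else x₀
  have hf₁ : ContinuousOn f D₁ := by
    rw [continuousOn_iff_continuous_domRestrict]
    have : D₁.domRestrict f = fun y : D₁ => s ⟨y.1.1, y.2⟩ y.1.2 := by
      ext y
      exact dif_pos y.2
    rw [this]
    have h1 : Continuous fun y : D₁ => s ⟨y.1.1, y.2⟩ := hs.comp (by fun_prop)
    exact h1.eval (by fun_prop)
  have hf₂' : ∀ y (hy : y ∈ D₂), f y = (ι y.1).1 ⟨y.2.1, hsph _ hy⟩ := by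
    intro y hy
    by_cases h : y.1 ∈ C
    · have := congrArg (fun γ : SphereSpace n X => γ.1 ⟨y.2.1, hsph _ hy⟩) (hsι ⟨y.1, h⟩)
      exact (dif_pos h).trans this
    · exact (dif_neg h).trans (dif_pos hy)
  have hf₂ : ContinuousOn f D₂ := by
    rw [continuousOn_iff_continuous_domRestrict]
    have : D₂.domRestrict f = fun y : D₂ => (ι y.1.1).1 ⟨y.1.2.1, hsph _ y.2⟩ := by
      ext y
      exact hf₂' y.1 y.2
    rw [this]
    have h1 : Continuous fun y : D₂ => (ι y.1.1).1 :=
      continuous_subtype_val.comp (hι.comp (by fun_prop))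
    exact h1.eval (by fun_prop)
  have hf : ContinuousOn f (D₁ ∪ D₂) := hf₁.union_of_isClosed hf₂ hD₁ hD₂
  obtain ⟨U, hU, hDU, g, hg⟩ := hX.2 (T × UBall n) (D₁ ∪ D₂) (hD₁.union hD₂)
    ⟨_, continuousOn_iff_continuous_domRestrict.1 hf⟩
  let W : Set T := {t | ∀ p : UBall n, (t, p) ∈ U}
  have hW : IsOpen W := by
    rw [isOpen_iff_mem_nhds]
    intro t ht
    obtain ⟨u, v, hu, -, htu, hv, huv⟩ := generalized_tube_lemma (isCompact_singleton (x := t))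
      (isCompact_univ (X := UBall n)) hU (by rintro ⟨a, b⟩ ⟨rfl, -⟩; exact ht b)
    exact Filter.mem_of_superset (hu.mem_nhds (htu rfl)) fun a ha p => huv ⟨ha, hv trivial⟩
  have hcont : Continuous fun y : W × UBall n => g ⟨(y.1.1, y.2), y.1.2 y.2⟩ :=
    g.continuous.comp (by fun_prop)
  refine ⟨W, hW, fun c hc p => hDU (Or.inl hc),
    ContinuousMap.curry ⟨_, hcont⟩, (ContinuousMap.curry _).continuous, fun t => ?_⟩
  apply Subtype.ext
  ext p
  have hp : ((t.1, sphereIncl n p) : T × UBall n) ∈ D₂ := by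
    change ‖p.1‖ = 1
    simp
  change g ⟨(t.1, sphereIncl n p), t.2 _⟩ = _
  exact (hg ⟨_, Or.inr hp⟩).trans (hf₂' _ hp)

/-- The pieces are only relatively open in `B`, so the cover is first shrunk to closed sets, from
which the fillings extend. -/
theorem FillCover.exists_isOpen [TopologicalSpace.MetrizableSpace T] (hX : IsMetrizableANR X)
    {ι : T → SphereSpace n X} (hι : Continuous ι) {B : Set T} (hB : IsClosed B) {k : ℕ}
    (h : FillCover ι B k) :
    ∃ W : Fin k → Set T, (∀ i, IsOpen (W i)) ∧ B ⊆ ⋃ i, W i ∧ ∀ i, HasFilling ι (W i) := by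
  obtain ⟨U, hU, hBU, hs⟩ := h
  obtain ⟨v, hBv, hv, hvU⟩ := exists_subset_iUnion_closed_subset hB hU
    (fun _ _ => Set.toFinite _) hBU
  have := fun i => HasFilling.exists_isOpen hX hι (hB.inter (hv i))
    ((hs i).mono (inter_subset_inter_right B (hvU i)))
  choose W hW hBW hWs using this
  refine ⟨W, hW, fun b hb => ?_, hWs⟩
  obtain ⟨i, hi⟩ := mem_iUnion.1 (hBv hb)
  exact mem_iUnion.2 ⟨i, hBW i ⟨hb, hi⟩⟩

theorem FillCover.exists_nhds [TopologicalSpace.MetrizableSpace T] (hX : IsMetrizableANR X)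
    {ι : T → SphereSpace n X} (hι : Continuous ι) {B : Set T} (hB : IsClosed B) {k : ℕ}
    (h : FillCover ι B k) : ∃ V, IsOpen V ∧ B ⊆ V ∧ FillCover ι (closure V) k := by
  obtain ⟨W, hW, hBW, hs⟩ := h.exists_isOpen hX hι hB
  obtain ⟨V, hV, hBV, hVW⟩ := normal_exists_closure_subset hB (isOpen_iUnion hW) hBW
  exact ⟨V, hV, hBV, W, hW, hVW, fun i => (hs i).mono inter_subset_right⟩

/-- Pieces relatively open in `B` or in `C` need not be so in `B ∪ C`; closedness allows them to be
replaced by open sets of `T`. -/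
theorem FillCover.union [TopologicalSpace.MetrizableSpace T] (hX : IsMetrizableANR X)
    {ι : T → SphereSpace n X} (hι : Continuous ι) {B C : Set T} (hB : IsClosed B)
    (hC : IsClosed C) {k l : ℕ} (h : FillCover ι B k) (h' : FillCover ι C l) :
    FillCover ι (B ∪ C) (k + l) := by
  obtain ⟨W, hW, hBW, hs⟩ := h.exists_isOpen hX hι hB
  obtain ⟨W', hW', hBW', hs'⟩ := h'.exists_isOpen hX hι hC
  refine ⟨Fin.append W W', fun i => ?_, ?_, fun i => HasFilling.mono ?_ inter_subset_right⟩
  · refine Fin.addCases (fun i => ?_) (fun i => ?_) i <;> simp [hW, hW']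
  · rintro b (hb | hb)
    · obtain ⟨i, hi⟩ := mem_iUnion.1 (hBW hb)
      exact mem_iUnion.2 ⟨Fin.castAdd l i, by simpa using hi⟩
    · obtain ⟨i, hi⟩ := mem_iUnion.1 (hBW' hb)
      exact mem_iUnion.2 ⟨Fin.natAdd k i, by simpa using hi⟩
  · refine Fin.addCases (fun i => ?_) (fun i => ?_) i <;> simp [hs, hs']

end Extension

/-! ### Gluing a homotopy onto a filling -/

section Gluing

variable {n : ℕ} {X : Type u} [TopologicalSpace X] {T : Type*} [TopologicalSpace T]

theorem ball_stretch_norm (n : ℕ) (x : UBall n) :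
    ‖(2 / max 1 (2 * ‖x.1‖)) • x.1‖ = 2 * ‖x.1‖ / max 1 (2 * ‖x.1‖) := by
  have h : (0 : ℝ) < max 1 (2 * ‖x.1‖) := lt_max_of_lt_left one_pos
  rw [norm_smul, Real.norm_of_nonneg (by positivity)]
  ring

/-- The map of the ball to itself that stretches the ball of radius `1/2` to the whole ball and
retracts its complement radially to the sphere. -/
noncomputable def ballStretch (n : ℕ) (x : UBall n) : UBall n :=
  ⟨(2 / max 1 (2 * ‖x.1‖)) • x.1, by
    rw [mem_closedBall_zero_iff, ball_stretch_norm]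
    exact div_le_one_of_le₀ (le_max_right _ _) (le_max_of_le_left zero_le_one)⟩

theorem continuous_ballStretch (n : ℕ) : Continuous (ballStretch n) := by
  refine Continuous.subtype_mk (f := fun x : UBall n => (2 / max 1 (2 * ‖x.1‖)) • x.1)
    (Continuous.fun_smul ?_ continuous_subtype_val) _
  refine continuous_const.div (by fun_prop) fun x => ?_
  exact (lt_max_of_lt_left one_pos).ne'

theorem ballStretch_mem_sphere {n : ℕ} {x : UBall n} (hx : 1 / 2 ≤ ‖x.1‖) :
    (ballStretch n x).1 ∈ Metric.sphere (0 : EuclideanSpace ℝ (Fin (n + 1))) 1 := by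
  rw [mem_sphere_zero_iff_norm]
  change ‖(2 / max 1 (2 * ‖x.1‖)) • x.1‖ = 1
  rw [ball_stretch_norm, max_eq_right (by linarith)]
  exact div_self (by linarith)

theorem ballStretch_sphereIncl {n : ℕ} (p : USphere n) :
    (ballStretch n (sphereIncl n p)).1 = p.1 := by
  have hp : ‖(sphereIncl n p).1‖ = 1 := by
    change ‖p.1‖ = 1
    simp
  change (2 / max 1 (2 * ‖(sphereIncl n p).1‖)) • (sphereIncl n p).1 = p.1
  rw [hp]
  norm_num
  rfl

instance usphere_nonempty (n : ℕ) : Nonempty (USphere n) :=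
  (NormedSpace.sphere_nonempty.2 zero_le_one).to_subtype

/-- A filling at the end of a homotopy of spheres yields a filling at its start. -/
theorem HasFilling.of_homotopy {ι : T → SphereSpace n X} {V : Set T}
    {h : V × unitInterval → SphereSpace n X} (hh : Continuous h) (h0 : ∀ v, h (v, 0) = ι v)
    {s : V → C(UBall n, X)} (hs : Continuous s) (h1 : ∀ v, sphereRestrict n X (s v) = h (v, 1)) :
    HasFilling ι V := by
  classical
  obtain ⟨p₀⟩ := usphere_nonempty n
  let rad : UBall n → USphere n := fun x =>
    if hx : 1 / 2 ≤ ‖x.1‖ then ⟨(ballStretch n x).1, ballStretch_mem_sphere hx⟩ else p₀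
  have hrad : ContinuousOn rad {x | 1 / 2 ≤ ‖x.1‖} := by
    rw [continuousOn_iff_continuous_domRestrict]
    have : Set.domRestrict {x : UBall n | 1 / 2 ≤ ‖x.1‖} rad =
        fun x => ⟨(ballStretch n x.1).1, ballStretch_mem_sphere x.2⟩ := by
      ext1 x
      exact dif_pos x.2
    rw [this]
    exact Continuous.subtype_mk (continuous_subtype_val.comp
      ((continuous_ballStretch n).comp continuous_subtype_val)) _
  have hradIncl : ∀ x : UBall n, 1 / 2 ≤ ‖x.1‖ → sphereIncl n (rad x) = ballStretch n x := by
    intro x hx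
    have : rad x = ⟨(ballStretch n x).1, ballStretch_mem_sphere hx⟩ := dif_pos hx
    rw [this]
    rfl
  let τ : UBall n → unitInterval := fun x => Set.projIcc 0 1 zero_le_one (2 - 2 * ‖x.1‖)
  have hτ : Continuous τ := continuous_projIcc.comp (by fun_prop)
  -- The half-radius ball carries the rescaled filling; on the collar, `τ` runs the homotopy from
  -- time `1` at radius `1/2` back to time `0` at the boundary. The default `p₀` in `rad` is never
  -- used here.
  let f : V × UBall n → X := fun y =>
    if ‖y.2.1‖ ≤ 1 / 2 then s y.1 (ballStretch n y.2) else (h (y.1, τ y.2)).1 (rad y.2)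
  have hf : Continuous f := by
    refine continuous_if_le (by fun_prop) continuous_const ?_ ?_ ?_
    · have : Continuous fun y : V × UBall n => s y.1 (ballStretch n y.2) :=
        (hs.comp continuous_fst).eval ((continuous_ballStretch n).comp continuous_snd)
      exact this.continuousOn
    · have h1 : Continuous fun y : V × UBall n => (h (y.1, τ y.2)).1 :=
        continuous_subtype_val.comp (hh.comp (by fun_prop))
      have h2 : ContinuousOn (fun y : V × UBall n => rad y.2) {y | 1 / 2 ≤ ‖y.2.1‖} :=
        hrad.comp continuous_snd.continuousOn fun y hy => hy
      exact h1.continuousOn.eval h2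
    · intro y hy
      have hτ1 : τ y.2 = 1 := by
        apply Subtype.ext
        norm_num [τ, hy, projIcc]
      rw [hτ1, ← h1, ← hradIncl _ hy.ge]
      rfl
  refine ⟨ContinuousMap.curry ⟨f, hf⟩, (ContinuousMap.curry _).continuous, fun v => ?_⟩
  apply Subtype.ext
  ext p
  have hp : ‖(sphereIncl n p).1‖ = 1 := by
    change ‖p.1‖ = 1
    simp
  have hτ0 : τ (sphereIncl n p) = 0 := by
    apply Subtype.ext
    simp [τ, hp, projIcc]
  have hr : rad (sphereIncl n p) = p := by
    apply Subtype.ext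
    rw [← ballStretch_sphereIncl p]
    exact congrArg Subtype.val (hradIncl (sphereIncl n p) (by rw [hp]; norm_num))
  change f (v, sphereIncl n p) = _
  have : ¬ ‖(sphereIncl n p).1‖ ≤ 1 / 2 := by rw [hp]; norm_num
  refine (if_neg this).trans ?_
  dsimp only
  rw [hτ0, hr, h0]

/-- Pulling back along `g` fills `ι ∘ g`, and the homotopy from `ι` to `ι ∘ g` supplies the collar
that turns this into a filling of `ι`. -/
theorem FillCover.of_image {ι : T → SphereSpace n X} (hι : Continuous ι) {g : C(T, T)}
    (hg : (ContinuousMap.id T).Homotopic g) {B : Set T} {k : ℕ} (h : FillCover ι (g '' B) k) :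
    FillCover ι B k := by
  obtain ⟨U, hU, hBU, hs⟩ := h
  obtain ⟨H⟩ := hg
  refine ⟨fun i => g ⁻¹' U i, fun i => (hU i).preimage g.continuous, fun b hb => ?_, fun i => ?_⟩
  · obtain ⟨i, hi⟩ := mem_iUnion.1 (hBU (mem_image_of_mem g hb))
    exact mem_iUnion.2 ⟨i, hi⟩
  · obtain ⟨s, hs, hsι⟩ := (hs i).comp (f := g) (ι' := ι ∘ g) (V' := B ∩ g ⁻¹' U i)
      g.continuous.continuousOn (fun b hb => ⟨mem_image_of_mem g hb.1, hb.2⟩) fun _ _ => rfl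
    refine HasFilling.of_homotopy (h := fun y => ι (H (y.2, y.1.1))) ?_ ?_ hs fun v => ?_
    · exact hι.comp (H.continuous.comp (by fun_prop))
    · intro v; simp
    · rw [hsι]; simp

theorem exists_filling (γ : SphereSpace n X) : ∃ β : C(UBall n, X), sphereRestrict n X β = γ := by
  obtain ⟨x, ⟨H⟩⟩ := γ.2
  -- The homotopy must stay within nullhomotopic spheres: the sphere at time `t` is contracted by
  -- the rest of `H`, waiting until time `t`.
  have hnull : ∀ t, ((⟨fun p => H (t, p), by fun_prop⟩ : C(USphere n, X))).Nullhomotopic := by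
    intro t
    refine ⟨x, ⟨⟨⟨fun y => H (max t y.1, y.2), by fun_prop⟩, fun p => ?_, fun p => ?_⟩⟩⟩
    · change H (max t 0, p) = H (t, p)
      rw [max_eq_left unitInterval.nonneg']
    · change H (max t 1, p) = _
      rw [max_eq_right unitInterval.le_one', H.apply_one]
  have : HasFilling (fun _ : Unit => γ) univ := by
    refine HasFilling.of_homotopy (h := fun y => ⟨⟨fun p => H (y.2, p), by fun_prop⟩, hnull _⟩)
      ?_ ?_ (s := fun _ => ContinuousMap.const _ x) continuous_const fun v => ?_
    · refine Continuous.subtype_mk ?_ _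
      refine ContinuousMap.continuous_of_continuous_uncurry _ ?_
      exact H.continuous.comp (f := fun y : (↥(univ : Set Unit) × ↥unitInterval) × USphere n =>
        (y.1.2, y.2)) (by fun_prop)
    · intro v
      apply Subtype.ext
      ext p
      exact H.apply_zero p
    · apply Subtype.ext
      ext p
      exact (H.apply_one p).symm
  obtain ⟨s, -, hs⟩ := this
  exact ⟨s ⟨(), trivial⟩, hs _⟩

end Gluing

/-! ### Fillings over orbits and constant maps -/

section Orbits

variable {n : ℕ} {X : Type u} [TopologicalSpace X]

theorem isCompact_orthogonalGroup (n : ℕ) :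
    IsCompact (Matrix.orthogonalGroup (Fin (n + 1)) ℝ : Set (Matrix (Fin (n + 1)) (Fin (n + 1)) ℝ)) := by
  have hK : IsCompact {M : Matrix (Fin (n + 1)) (Fin (n + 1)) ℝ |
      ∀ i, M i ∈ {r : Fin (n + 1) → ℝ | ∀ j, r j ∈ Icc (-1 : ℝ) 1}} :=
    isCompact_pi_infinite fun _ => isCompact_pi_infinite fun _ => isCompact_Icc
  refine hK.of_isClosed_subset ?_ fun M hM i j => ?_
  · have : (Matrix.orthogonalGroup (Fin (n + 1)) ℝ : Set (Matrix (Fin (n + 1)) (Fin (n + 1)) ℝ)) =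
        {M | M * M.transpose = 1} := by
      ext M
      simp [Matrix.mem_orthogonalGroup_iff]
    rw [this]
    exact isClosed_eq (by fun_prop) continuous_const
  · exact abs_le.1 (entry_norm_bound_of_unitary hM i j)

instance compactSpace_OGroup (n : ℕ) : CompactSpace (OGroup n) :=
  isCompact_iff_compactSpace.1 (isCompact_orthogonalGroup n)

theorem orthogonal_mulVec_norm {n : ℕ} (g : OGroup n) (x : EuclideanSpace ℝ (Fin (n + 1))) :
    ‖WithLp.toLp 2 (g.1.mulVec x.ofLp)‖ = ‖x‖ := by
  have hg : g.1.transpose * g.1 = 1 := by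
    simpa using (Matrix.mem_orthogonalGroup_iff' (Fin (n + 1)) ℝ).1 g.2
  rw [← sq_eq_sq₀ (norm_nonneg _) (norm_nonneg _), ← real_inner_self_eq_norm_sq,
    ← real_inner_self_eq_norm_sq]
  simp only [EuclideanSpace.inner_eq_star_dotProduct, star_trivial]
  rw [Matrix.dotProduct_mulVec, Matrix.vecMul_mulVec, hg, Matrix.vecMul_one]

/-- The action of `O(n+1)` on the unit ball. -/
def rotateBall {n : ℕ} (g : OGroup n) (x : UBall n) : UBall n :=
  ⟨WithLp.toLp 2 (g.1.mulVec x.1.ofLp), by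
    rw [mem_closedBall_zero_iff, orthogonal_mulVec_norm]
    exact mem_closedBall_zero_iff.1 x.2⟩

theorem continuous_rotateBall (n : ℕ) :
    Continuous fun y : OGroup n × UBall n => rotateBall y.1 y.2 := by
  refine Continuous.subtype_mk
    (f := fun y : OGroup n × UBall n => WithLp.toLp 2 (y.1.1.mulVec y.2.1.ofLp)) ?_ _
  fun_prop

theorem continuous_inv_OGroup (n : ℕ) : Continuous fun g : OGroup n => g⁻¹ := by
  rw [continuous_induced_rng]
  have : (Subtype.val ∘ fun g : OGroup n => g⁻¹) = fun g => star g.1 := by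
    ext1 g
    rfl
  rw [this]
  exact continuous_subtype_val.star

theorem smul_sphereRestrict (g : OGroup n) (β : C(UBall n, X)) (β' : C(UBall n, X))
    (h : ∀ x, β' x = β (rotateBall g⁻¹ x)) :
    g • sphereRestrict n X β = sphereRestrict n X β' := by
  apply Subtype.ext
  ext p
  exact (h (sphereIncl n p)).symm

theorem continuous_sphereRestrict : Continuous (sphereRestrict n X) :=
  Continuous.subtype_mk (ContinuousMap.continuous_precomp _) _

/-- The rotated filling `β ∘ g⁻¹`. -/
def rotateFilling (β : C(UBall n, X)) : C(OGroup n, C(UBall n, X)) :=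
  ContinuousMap.curry ⟨fun y => β (rotateBall y.1⁻¹ y.2), β.continuous.comp
    ((continuous_rotateBall n).comp
      (((continuous_inv_OGroup n).comp continuous_fst).prodMk continuous_snd))⟩

theorem smul_eq_sphereRestrict (g : OGroup n) (β : C(UBall n, X)) :
    g • sphereRestrict n X β = sphereRestrict n X (rotateFilling β g) :=
  smul_sphereRestrict g β _ fun _ => rfl

/-- Every `γ` bounds some `β`, so the orbit map is the restriction of the continuous family of
rotated fillings. -/
theorem continuous_smul_sphere (γ : SphereSpace n X) : Continuous fun g : OGroup n => g • γ := by
  obtain ⟨β, rfl⟩ := exists_filling γ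
  simp only [smul_eq_sphereRestrict]
  exact continuous_sphereRestrict.comp (rotateFilling β).continuous

theorem isCompact_sphere_orbit {G : Subgroup (OGroup n)} (hG : IsClosed (G : Set (OGroup n)))
    (γ : SphereSpace n X) : IsCompact (MulAction.orbit G γ) := by
  have : CompactSpace G := isCompact_iff_compactSpace.1 hG.isCompact
  exact isCompact_range (f := fun g : G => g • γ)
    ((continuous_smul_sphere γ).comp continuous_subtype_val)

/-- With trivial isotropy the orbit map is a continuous bijection from the compact group `G` to a
Hausdorff space, hence a homeomorphism. Each point of the orbit thus determines, continuously, the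
rotation to apply to one fixed filling of `γ`. -/
theorem hasFilling_orbit [T2Space X] {G : Subgroup (OGroup n)} (hG : IsClosed (G : Set (OGroup n)))
    (γ : SphereSpace n X) (hγ : MulAction.stabilizer G γ = ⊥) :
    HasFilling (id : SphereSpace n X → SphereSpace n X) (MulAction.orbit G γ) := by
  have : CompactSpace G := isCompact_iff_compactSpace.1 hG.isCompact
  have hinj : Function.Injective fun g : G => g • γ := by
    intro g g' h
    have h1 : g'⁻¹ * g ∈ MulAction.stabilizer G γ := by
      rw [MulAction.mem_stabilizer_iff, mul_smul, inv_smul_eq_iff]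
      exact h
    rw [hγ, Subgroup.mem_bot, inv_mul_eq_one] at h1
    exact h1.symm
  have hcont : Continuous fun g : G => g • γ :=
    (continuous_smul_sphere γ).comp continuous_subtype_val
  let e : G ≃ MulAction.orbit G γ := Equiv.ofInjective _ hinj
  have he : Continuous e := Continuous.subtype_mk hcont _
  let e' : G ≃ₜ MulAction.orbit G γ := he.homeoOfEquivCompactToT2
  obtain ⟨β, hβ⟩ := exists_filling γ
  refine ⟨fun v => rotateFilling β (e'.symm v).1, ?_, fun v => ?_⟩
  · exact (rotateFilling β).continuous.comp (continuous_subtype_val.comp e'.symm.continuous)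
  · rw [← smul_eq_sphereRestrict, hβ]
    exact congrArg Subtype.val (e'.apply_symm_apply v)

theorem isClosed_constMaps [T2Space X] : IsClosed (constMaps n X) := by
  obtain ⟨p₀⟩ := usphere_nonempty n
  have : constMaps n X = ⋂ p : USphere n, {γ | γ.1 p = γ.1 p₀} := by
    ext γ
    simp only [mem_iInter, mem_ofPred_eq]
    constructor
    · rintro ⟨x, hx⟩ p
      rw [hx]
      rfl
    · intro h
      exact ⟨γ.1 p₀, ContinuousMap.ext h⟩
  rw [this]
  exact isClosed_iInter fun p => isClosed_eq (by fun_prop) (by fun_prop)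

theorem hasFilling_constMaps :
    HasFilling (id : SphereSpace n X → SphereSpace n X) (constMaps n X) := by
  obtain ⟨p₀⟩ := usphere_nonempty n
  refine ⟨fun v => ContinuousMap.const _ (v.1.1 p₀), ?_, fun v => ?_⟩
  · exact ContinuousMap.continuous_const'.comp (by fun_prop)
  · obtain ⟨x, hx⟩ := v.2
    apply Subtype.ext
    change (ContinuousMap.const (UBall n) (v.1.1 p₀)).comp _ = v.1.1
    rw [hx]
    rfl

end Orbits

/-! ### Descent of `F` under condition (D) -/

section Dynamics

variable {T : Type*} [TopologicalSpace T] {F : C(T, ℝ)} {φ : C(T, T)}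

theorem ConditionD.map_le (hD : ConditionD F φ) (y : T) : F (φ y) ≤ F y := by
  by_cases h : φ y = y
  · rw [h]
  · exact (hD.decreasing y h).le

theorem ConditionD.iterate_antitone (hD : ConditionD F φ) (y : T) :
    Antitone fun k => F (φ^[k] y) :=
  antitone_nat_of_succ_le fun k => by
    rw [Function.iterate_succ_apply']
    exact hD.map_le _

/-- Without a uniform gap, (D) would place a fixed point in the closure of `B`, which is `B` itself.
-/
theorem ConditionD.exists_gap (hD : ConditionD F φ) {B : Set T} (hB : IsClosed B) {a b : ℝ}
    (hBF : ∀ y ∈ B, F y ∈ Icc a b) (hfix : ∀ y ∈ B, φ y ≠ y) :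
    ∃ δ > 0, ∀ y ∈ B, F (φ y) ≤ F y - δ := by
  by_contra hcon
  obtain ⟨y, hyB, hy⟩ := hD.compactness B
    ⟨max |a| |b|, fun y hy => abs_le_max_abs_abs (hBF y hy).1 (hBF y hy).2⟩ (by
      rintro ⟨δ, hδ, h⟩
      refine hcon ⟨δ, hδ, fun y hy => ?_⟩
      have h1 := h y hy
      rw [abs_of_nonneg (sub_nonneg.2 (hD.map_le y))] at h1
      linarith)
  rw [hB.closure_eq] at hyB
  exact hfix y hyB hy

theorem isClosed_sublevel (F : C(T, ℝ)) (c : ℝ) : IsClosed {y | F y ≤ c} :=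
  isClosed_le F.continuous continuous_const

theorem ConditionD.exists_gap_Icc (hD : ConditionD F φ) {a b : ℝ}
    (hfix : ∀ y, φ y = y → F y ∉ Icc a b) :
    ∃ δ > 0, ∀ y, F y ∈ Icc a b → F (φ y) ≤ F y - δ :=
  hD.exists_gap (B := F ⁻¹' Icc a b) (isClosed_Icc.preimage F.continuous) (fun _ hy => hy)
    fun y hy h => hfix y h hy

theorem ConditionD.exists_iterate_le (hD : ConditionD F φ) {a b : ℝ}
    (hfix : ∀ y, φ y = y → F y ∉ Icc a b) : ∃ k, ∀ y, F y ≤ b → F (φ^[k] y) ≤ a := by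
  obtain ⟨δ, hδ, h⟩ := hD.exists_gap_Icc hfix
  -- The maximum records that a point already below `a` stays there, while any other point loses `δ`
  -- at each step.
  have key : ∀ k : ℕ, ∀ y, F y ≤ b → F (φ^[k] y) ≤ max a (b - k * δ) := by
    intro k
    induction k with
    | zero => intro y hy; simp [hy]
    | succ k ih =>
      intro y hy
      rw [Function.iterate_succ_apply']
      have h1 := ih y hy
      by_cases h2 : F (φ^[k] y) ≤ a
      · exact ((hD.map_le _).trans h2).trans (le_max_left _ _)
      · refine le_max_of_le_right ?_
        have h3 : F (φ^[k] y) ≤ b - k * δ := (le_max_iff.1 h1).resolve_left h2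
        have h4 := h (φ^[k] y) ⟨(not_le.1 h2).le, h3.trans (by
          have : (0 : ℝ) ≤ k * δ := by positivity
          linarith)⟩
        push_cast
        linarith
  obtain ⟨k, hk⟩ := exists_nat_gt ((b - a) / δ)
  refine ⟨k, fun y hy => (key k y hy).trans (max_le le_rfl ?_)⟩
  rw [div_lt_iff₀ hδ] at hk
  linarith

variable {n : ℕ} {X : Type u} [TopologicalSpace X] {ι : T → SphereSpace n X}

/-- Each application of `φ` pushes the sublevel set down by a fixed `δ` until level `a` is reached,
and `hφ` pulls the cover back one step at a time. -/
theorem FillCover.sublevel_of_no_fixed (hD : ConditionD F φ)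
    (hφ : ∀ B : Set T, IsClosed B → ∀ k, FillCover ι (φ '' B) k → FillCover ι B k) {a b : ℝ}
    (hfix : ∀ y, φ y = y → F y ∉ Icc a b) {k : ℕ} (h : FillCover ι {y | F y ≤ a} k) :
    FillCover ι {y | F y ≤ b} k := by
  obtain ⟨δ, hδ, hgap⟩ := hD.exists_gap_Icc hfix
  have key : ∀ j : ℕ, FillCover ι {y | F y ≤ max a (b - j * δ)} k →
      FillCover ι {y | F y ≤ b} k := by
    intro j
    induction j with
    | zero =>
      refine fun h => h.mono fun y (hy : F y ≤ b) => ?_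
      change F y ≤ _
      exact le_max_of_le_right (by simpa using hy)
    | succ j ih =>
      refine fun h => ih (hφ _ (isClosed_sublevel F _) _ (h.mono ?_))
      rintro _ ⟨y, hy, rfl⟩
      rw [mem_ofPred_eq] at hy ⊢
      by_cases h2 : F y ≤ a
      · exact ((hD.map_le _).trans h2).trans (le_max_left _ _)
      · refine le_max_of_le_right ?_
        have h3 : F y ≤ b - j * δ := (le_max_iff.1 hy).resolve_left h2
        have h4 := hgap y ⟨(not_le.1 h2).le, h3.trans (by
          have : (0 : ℝ) ≤ j * δ := by positivity
          linarith)⟩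
        push_cast
        linarith
  obtain ⟨j, hj⟩ := exists_nat_gt ((b - a) / δ)
  rw [div_lt_iff₀ hδ] at hj
  refine key j (h.mono fun y (hy : F y ≤ _) => hy.trans (max_le le_rfl ?_))
  linarith

end Dynamics

/-! ### Counting critical levels -/

section Counting

variable {T : Type u} [TopologicalSpace T] [TopologicalSpace.MetrizableSpace T]
  {F : C(T, ℝ)} {φ : C(T, T)}
  {n : ℕ} {X : Type u} [TopologicalSpace X] {ι : T → SphereSpace n X}

theorem isClosed_fixed_level (F : C(T, ℝ)) (φ : C(T, T)) (v : ℝ) :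
    IsClosed {y | φ y = y ∧ F y = v} :=
  (isClosed_eq φ.continuous continuous_id).inter (isClosed_eq F.continuous continuous_const)

/-- A neighbourhood `V` of the fixed points at level `v` still needs only `k` pieces. Off `V`, `φ`
sends the sublevel set just above `v` below `w`, so `l` pieces suffice there. The level `w` is
chosen before `l`, so that it can serve as the next top level in the induction. -/
theorem FillCover.cross_critical_level (hX : IsMetrizableANR X) (hι : Continuous ι)
    (hD : ConditionD F φ)
    (hφ : ∀ B : Set T, IsClosed B → ∀ k, FillCover ι (φ '' B) k → FillCover ι B k)
    {w₀ v c : ℝ} (hwv : w₀ < v)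
    (hfix : ∀ y, φ y = y → F y ∈ Icc w₀ c → F y = v) {k : ℕ}
    (hK : FillCover ι {y | φ y = y ∧ F y = v} k) :
    ∃ w, w₀ ≤ w ∧ w < v ∧ ∀ l, FillCover ι {y | F y ≤ w} l →
      FillCover ι {y | F y ≤ c} (l + k) := by
  obtain ⟨V, hV, hKV, hVk⟩ := hK.exists_nhds hX hι (isClosed_fixed_level F φ v)
  obtain ⟨δ, hδ, hgap⟩ := hD.exists_gap (B := F ⁻¹' Icc w₀ c ∩ Vᶜ) (a := w₀) (b := c)
    ((isClosed_Icc.preimage F.continuous).inter hV.isClosed_compl) (fun y hy => hy.1)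
    fun y hy h => hy.2 (hKV ⟨h, hfix y h hy.1⟩)
  -- The drop `δ` is split evenly: points off `V` at level at most `v + δ / 2` land at or below `v -
  -- δ / 2`, unless they start below `w₀`.
  refine ⟨max w₀ (v - δ / 2), le_max_left _ _, max_lt hwv (by linarith), fun l hl => ?_⟩
  have hV' : FillCover ι ({y | F y ≤ min c (v + δ / 2)} ∩ Vᶜ) l := by
    refine hφ _ ((isClosed_sublevel F _).inter hV.isClosed_compl) _ (hl.mono ?_)
    rintro _ ⟨y, ⟨hy, hyV⟩, rfl⟩
    replace hy : F y ≤ c ∧ F y ≤ v + δ / 2 := le_min_iff.1 hy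
    by_cases h : F y ≤ w₀
    · exact ((hD.map_le y).trans h).trans (le_max_left _ _)
    · change F (φ y) ≤ _
      refine le_max_of_le_right ?_
      have := hgap y ⟨⟨(not_le.1 h).le, hy.1⟩, hyV⟩
      linarith
  have hc' : FillCover ι {y | F y ≤ min c (v + δ / 2)} (l + k) := by
    refine (hV'.union hX hι ((isClosed_sublevel F _).inter hV.isClosed_compl) isClosed_closure
      hVk).mono fun y hy => ?_
    by_cases h : y ∈ V
    · exact Or.inr (subset_closure h)
    · exact Or.inl ⟨hy, h⟩
  rcases le_total c (v + δ / 2) with h | h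
  · rwa [min_eq_left h] at hc'
  · rw [min_eq_right h] at hc'
    refine hc'.sublevel_of_no_fixed hD hφ fun y hy hyI => ?_
    have := hfix y hy ⟨by linarith [hyI.1], hyI.2⟩
    linarith [hyI.1]

/-- Induction removes the highest critical value; `c` varies so that it can be lowered past that
value. In the base case there is no fixed point up to level `c`, and a level below the lower bound
of `F` has empty sublevel set. -/
theorem FillCover.sublevel_of_levels (hX : IsMetrizableANR X) (hι : Continuous ι)
    (hD : ConditionD F φ) (hbdd : BddBelow (range F))
    (hφ : ∀ B : Set T, IsClosed B → ∀ k, FillCover ι (φ '' B) k → FillCover ι B k)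
    (q : ℝ → ℕ) (s : Finset ℝ) : ∀ c : ℝ, (∀ v, v ∈ s ↔ v ≤ c ∧ ∃ y, φ y = y ∧ F y = v) →
    (∀ v ∈ s, FillCover ι {y | φ y = y ∧ F y = v} (q v)) →
    FillCover ι {y | F y ≤ c} (∑ v ∈ s, q v) := by
  classical
  induction s using Finset.induction_on_max with
  | empty =>
    intro c hs _
    obtain ⟨m, hm⟩ := hbdd
    refine FillCover.sublevel_of_no_fixed (a := m - 1) hD hφ (fun y hy hyI => ?_) ?_
    · simpa using (hs (F y)).2 ⟨hyI.2, y, hy, rfl⟩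
    · refine (FillCover.empty ι _).mono fun y hy => ?_
      have h1 : m ≤ F y := hm (mem_range_self y)
      have h2 : F y ≤ m - 1 := hy
      linarith
  | insert a s has ih =>
    intro c hs hq
    obtain ⟨hac, -⟩ := (hs a).1 (Finset.mem_insert_self a s)
    obtain ⟨w₀, hw₀, hw₀a⟩ : ∃ w₀, (∀ x ∈ s, x < w₀) ∧ w₀ < a := by
      have h1 : ∀ᶠ w in 𝓝[<] a, ∀ x ∈ s, x < w :=
        (Finset.eventually_all s).2 fun x hx => eventually_nhdsWithin_of_eventually_nhds
          (lt_mem_nhds (has x hx))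
      exact (h1.and self_mem_nhdsWithin).exists
    have hfix : ∀ y, φ y = y → F y ∈ Icc w₀ c → F y = a := fun y hy hyI =>
      (Finset.mem_insert.1 ((hs (F y)).2 ⟨hyI.2, y, hy, rfl⟩)).resolve_right fun h =>
        (hw₀ _ h).not_ge hyI.1
    obtain ⟨w, hw₀w, hwa, hw⟩ := FillCover.cross_critical_level hX hι hD hφ hw₀a hfix
      (hq a (Finset.mem_insert_self a s))
    rw [Finset.sum_insert fun h => lt_irrefl a (has a h), add_comm]
    refine hw _ (ih w (fun v => ⟨fun hv => ?_, fun hv => ?_⟩)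
      fun v hv => hq v (Finset.mem_insert_of_mem hv))
    · exact ⟨((hw₀ v hv).trans_le hw₀w).le, ((hs v).1 (Finset.mem_insert_of_mem hv)).2⟩
    · refine (Finset.mem_insert.1 ((hs v).2 ⟨hv.1.trans (hwa.le.trans hac), hv.2⟩)).resolve_left ?_
      exact (hv.1.trans_lt hwa).ne

theorem FillCover.biUnion (hX : IsMetrizableANR X) (hι : Continuous ι) {α : Type*}
    (C : α → Set T) (t : Finset α) (hC : ∀ i ∈ t, IsClosed (C i))
    (hs : ∀ i ∈ t, HasFilling ι (C i)) : FillCover ι (⋃ i ∈ t, C i) t.card := by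
  classical
  induction t using Finset.induction_on with
  | empty => simpa using FillCover.empty ι 0
  | insert a t ha ih =>
    rw [Finset.set_biUnion_insert, Finset.card_insert_of_notMem ha, add_comm]
    exact (hs a (Finset.mem_insert_self a t)).fillCover.union hX hι
      (hC a (Finset.mem_insert_self a t))
      (isClosed_biUnion_finset fun i hi => hC i (Finset.mem_insert_of_mem hi))
      (ih (fun i hi => hC i (Finset.mem_insert_of_mem hi))
        fun i hi => hs i (Finset.mem_insert_of_mem hi))

/-- Each piece lies on a single level of `F`, so sorting the pieces by level counts none twice. -/
theorem FillCover.sublevel_of_cover (hX : IsMetrizableANR X) (hι : Continuous ι)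
    (hD : ConditionD F φ) (hbdd : BddBelow (range F))
    (hφ : ∀ B : Set T, IsClosed B → ∀ k, FillCover ι (φ '' B) k → FillCover ι B k)
    {α : Type*} (C : α → Set T) (t : Finset α) (hC : ∀ i ∈ t, IsClosed (C i))
    (hs : ∀ i ∈ t, HasFilling ι (C i)) (val : α → ℝ) (hval : ∀ i ∈ t, ∀ y ∈ C i, F y = val i)
    (c : ℝ) (hcov : ∀ y, φ y = y → F y ≤ c → ∃ i ∈ t, y ∈ C i) :
    FillCover ι {y | F y ≤ c} t.card := by
  classical
  let s : Finset ℝ := (t.image val).filter fun v => v ≤ c ∧ ∃ y, φ y = y ∧ F y = v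
  have hmem : ∀ v, v ∈ s ↔ v ≤ c ∧ ∃ y, φ y = y ∧ F y = v := by
    refine fun v => ⟨fun h => (Finset.mem_filter.1 h).2, fun h => Finset.mem_filter.2 ⟨?_, h⟩⟩
    obtain ⟨hv, y, hy, rfl⟩ := h
    obtain ⟨i, hi, hyi⟩ := hcov y hy hv
    exact Finset.mem_image.2 ⟨i, hi, (hval i hi y hyi).symm⟩
  refine (FillCover.sublevel_of_levels hX hι hD hbdd hφ
    (fun v => (t.filter fun i => val i = v).card) s c hmem fun v hv => ?_).mono_right ?_
  · refine (FillCover.biUnion hX hι C (t.filter fun i => val i = v)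
      (fun i hi => hC i (Finset.mem_filter.1 hi).1)
      (fun i hi => hs i (Finset.mem_filter.1 hi).1)).mono ?_
    rintro y ⟨hy, hyv⟩
    obtain ⟨i, hi, hyi⟩ := hcov y hy (hyv.trans_le ((hmem v).1 hv).1)
    exact mem_biUnion (Finset.mem_filter.2 ⟨hi, (hval i hi y hyi).symm.trans hyv⟩) hyi
  · calc ∑ v ∈ s, (t.filter fun i => val i = v).card
        ≤ ∑ v ∈ t.image val, (t.filter fun i => val i = v).card :=
          Finset.sum_le_sum_of_subset (Finset.filter_subset _ _)
      _ = t.card := (Finset.card_eq_sum_card_image val t).symm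

end Counting

/-! ### Deforming the whole space below a level -/

section Flow

variable {T : Type*} [TopologicalSpace T] {F : C(T, ℝ)} {φ : C(T, T)}

/-- The path `H(a, ·), φ(H(a, ·)), φ²(H(a, ·)), …` issuing from `a`, for a homotopy `H` from the
identity to `φ`. -/
noncomputable def iteratedPath (H : (ContinuousMap.id T).Homotopy φ) (y : T × ℝ) : T :=
  φ^[⌊y.2⌋₊] (H (projIcc 0 1 zero_le_one (y.2 - ⌊y.2⌋₊), y.1))

theorem iteratedPath_zero (H : (ContinuousMap.id T).Homotopy φ) (a : T) :
    iteratedPath H (a, 0) = a := by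
  simp [iteratedPath]

theorem iteratedPath_eq (H : (ContinuousMap.id T).Homotopy φ) (k : ℕ) (a : T) {r : ℝ}
    (hr : r ∈ Icc (k : ℝ) (k + 1)) :
    iteratedPath H (a, r) = φ^[k] (H (projIcc 0 1 zero_le_one (r - k), a)) := by
  rcases hr.2.lt_or_eq with h | h
  · have : ⌊r⌋₊ = k := (Nat.floor_eq_iff (k.cast_nonneg.trans hr.1)).2 ⟨hr.1, h⟩
    simp [iteratedPath, this]
  -- At the right endpoint the floor has already jumped; the two formulas agree because `H` ends at
  -- `φ`.
  · have hfl : ⌊r⌋₊ = k + 1 := by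
      rw [h]
      exact_mod_cast Nat.floor_natCast (k + 1)
    have h0 : projIcc (0 : ℝ) 1 zero_le_one 0 = 0 := projIcc_left _
    have h1 : projIcc (0 : ℝ) 1 zero_le_one 1 = 1 := projIcc_right _
    simp only [iteratedPath, hfl]
    rw [h]
    push_cast
    rw [sub_self, add_sub_cancel_left, h0, h1, H.apply_zero, H.apply_one,
      Function.iterate_succ_apply]
    rfl

theorem continuousOn_iteratedPath (H : (ContinuousMap.id T).Homotopy φ) :
    ContinuousOn (iteratedPath H) {y | 0 ≤ y.2} := by
  let E : ℕ → Set (T × ℝ) := fun k => Prod.snd ⁻¹' Icc (k : ℝ) (k + 1)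
  have hE : LocallyFinite E := by
    intro y
    obtain ⟨N, hN⟩ := exists_nat_gt y.2
    refine ⟨{z | z.2 < N}, (isOpen_lt continuous_snd continuous_const).mem_nhds hN,
      (finite_Iio N).subset ?_⟩
    rintro k ⟨z, hzk, hzN⟩
    have h : (k : ℝ) < N := hzk.1.trans_lt hzN
    exact_mod_cast h
  refine (hE.continuousOn_iUnion (fun k => isClosed_Icc.preimage continuous_snd)
    fun k => ?_).mono fun y hy => ?_
  · have : Continuous fun y : T × ℝ => φ^[k] (H (projIcc 0 1 zero_le_one (y.2 - k), y.1)) :=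
      (φ.continuous.iterate k).comp
        (H.continuous.comp ((continuous_projIcc.comp (by fun_prop)).prodMk continuous_fst))
    exact this.continuousOn.congr fun y hy => iteratedPath_eq H k y.1 hy
  · exact mem_iUnion.2 ⟨⌊y.2⌋₊, Nat.floor_le hy, (Nat.lt_floor_add_one _).le⟩

/-- `F` may be unbounded above, so no single number of iterates serves all points. Near each point
one number does, since `F` is bounded on the compact path of `H` and on nearby ones. A partition of
unity then selects a continuous stopping time along the iterated path. -/
theorem ConditionD.exists_homotopic_le [TopologicalSpace.MetrizableSpace T]
    (hD : ConditionD F φ) (hφ : (ContinuousMap.id T).Homotopic φ) {c : ℝ}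
    (hfix : ∀ y, φ y = y → F y < c) :
    ∃ g : C(T, T), (ContinuousMap.id T).Homotopic g ∧ ∀ a, F (g a) ≤ c := by
  obtain ⟨H⟩ := hφ
  let _ := TopologicalSpace.metrizableSpaceMetric T
  -- Requiring the bound at all later times makes `t a` upward closed, hence convex, even though `F`
  -- may rise along `H`.
  let t : T → Set ℝ := fun a => {r | 0 ≤ r ∧ ∀ r' ≥ r, F (iteratedPath H (a, r')) ≤ c}
  have hconv : ∀ a, Convex ℝ (t a) := by
    refine fun a => OrdConnected.convex (𝕜 := ℝ) ⟨fun r hr r' _ x hx => ?_⟩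
    exact ⟨hr.1.trans hx.1, fun y hy => hr.2 y (hx.1.trans hy)⟩
  have hloc : ∀ a, ∃ r : ℝ, ∀ᶠ b in 𝓝 a, r ∈ t b := by
    intro a
    obtain ⟨M, hM⟩ : ∃ M, ∀ s : unitInterval, F (H (s, a)) < M := by
      have : BddAbove (range fun s : unitInterval => F (H (s, a))) :=
        (isCompact_range (by fun_prop)).bddAbove
      obtain ⟨M, hM⟩ := this
      exact ⟨M + 1, fun s => (hM (mem_range_self s)).trans_lt (lt_add_one M)⟩
    obtain ⟨k, hk⟩ := hD.exists_iterate_le (a := c) (b := M)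
      fun y hy hyI => (hfix y hy).not_ge hyI.1
    have hopen : IsOpen {y : unitInterval × T | F (H y) < M} :=
      isOpen_lt (by fun_prop) continuous_const
    obtain ⟨u, v, -, hv, hu, hav, huv⟩ := generalized_tube_lemma
      (isCompact_univ (X := unitInterval)) (isCompact_singleton (x := a)) hopen
      (by rintro ⟨s, b⟩ ⟨-, rfl⟩; exact hM s)
    refine ⟨k, Filter.mem_of_superset (hv.mem_nhds (hav rfl)) fun b hb => ⟨k.cast_nonneg,
      fun r hr => ?_⟩⟩
    refine (hD.iterate_antitone _ (Nat.le_floor hr)).trans (hk _ (le_of_lt ?_))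
    exact huv ⟨hu trivial, hb⟩
  obtain ⟨τ, hτ⟩ := exists_continuous_forall_mem_convex_of_local_const hconv hloc
  have hK : Continuous fun y : unitInterval × T => iteratedPath H (y.2, y.1 * τ y.2) :=
    (continuousOn_iteratedPath H).comp_continuous (by fun_prop)
      fun y => mul_nonneg y.1.2.1 (hτ y.2).1
  have hg : Continuous fun a => iteratedPath H (a, τ a) :=
    (continuousOn_iteratedPath H).comp_continuous (by fun_prop) fun a => (hτ a).1
  refine ⟨⟨_, hg⟩, ⟨⟨⟨_, hK⟩, fun a => ?_, fun a => ?_⟩⟩, fun a => (hτ a).2 _ le_rfl⟩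
  · simp [iteratedPath_zero]
  · simp

end Flow

/-! ### From orbits to the estimates -/

section Main

theorem IsMetrizableANR.metrizableSpace_sphereSpace {X : Type u} [TopologicalSpace X]
    (hX : IsMetrizableANR X) (n : ℕ) : TopologicalSpace.MetrizableSpace (SphereSpace n X) :=
  have := hX.1
  IsEmbedding.subtypeVal.metrizableSpace

variable {X : Type u} [TopologicalSpace X] {n : ℕ} {G : Subgroup (OGroup n)}
  {A : Set (SphereSpace n X)} {F : C(A, ℝ)} {φ : C(A, A)}

theorem IsAdmissible.sphericalComplexity_sublevelSet_le (hX : IsMetrizableANR X)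
    (hadm : IsAdmissible G A F φ) (hbdd : BddBelow (range F))
    (hφ : ∀ B : Set A, IsClosed B → ∀ k, FillCover (Subtype.val : A → SphereSpace n X) (φ '' B) k →
      FillCover (Subtype.val : A → SphereSpace n X) B k) (c : ℝ)
    (hstab : ∀ γ ∈ (fixSet φ ∩ sublevelSet F c) \ constMaps n X, MulAction.stabilizer G γ = ⊥)
    {m : ℕ} (hm : numNonconstOrbits G (fixSet φ ∩ sublevelSet F c) = m) :
    FillCover (Subtype.val : A → SphereSpace n X) {a | F a ≤ c} (m + 1) := by
  classical
  have := hX.1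
  have := hX.metrizableSpace_sphereSpace n
  set S := fixSet φ ∩ sublevelSet F c with hS
  have hfin : ((fun γ : SphereSpace n X => MulAction.orbit G γ) '' (S \ constMaps n X)).Finite :=
    finite_of_encard_eq_coe hm
  -- All constant maps together form a single piece, which accounts for the `+ 1`.
  let t : Finset (Set (SphereSpace n X)) := insert (constMaps n X) hfin.toFinset
  have ht : ∀ Q ∈ t, Q = constMaps n X ∨ ∃ γ ∈ S \ constMaps n X, MulAction.orbit G γ = Q :=
    fun Q hQ => (Finset.mem_insert.1 hQ).imp_right fun h => hfin.mem_toFinset.1 h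
  have hSA : ∀ γ ∈ S, γ ∈ A := by
    rintro _ ⟨⟨a, -, rfl⟩, -⟩
    exact a.2
  have hFQ : ∀ Q ∈ t, ∀ a b : A, a.1 ∈ Q → b.1 ∈ Q → F a = F b := by
    intro Q hQ a b ha hb
    rcases ht Q hQ with rfl | ⟨γ, hγ, rfl⟩
    · exact hadm.F_const a b ha hb
    · obtain ⟨g, hg⟩ := ha
      obtain ⟨g', hg'⟩ := hb
      rw [hadm.F_invariant g.1 g.2 ⟨γ, hSA γ hγ.1⟩ a hg.symm,
        hadm.F_invariant g'.1 g'.2 ⟨γ, hSA γ hγ.1⟩ b hg'.symm]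
  refine (FillCover.sublevel_of_cover hX continuous_subtype_val hadm.conditionD hbdd hφ
    (fun Q => Subtype.val ⁻¹' Q) t (fun Q hQ => ?_) (fun Q hQ => ?_)
    -- `F` takes a single value on each piece, so any point of it gives the level; `0` is used only
    -- for a set disjoint from `A`.
    (fun Q => if h : ∃ a : A, a.1 ∈ Q then F h.choose else 0) (fun Q hQ y hy => ?_) c
    fun y hy hyc => ?_).mono_right ?_
  · refine IsClosed.preimage continuous_subtype_val ?_
    rcases ht Q hQ with rfl | ⟨γ, -, rfl⟩
    · exact isClosed_constMaps
    · exact (isCompact_sphere_orbit hadm.isClosed_group γ).isClosed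
  · refine HasFilling.comp (ι := id) (V := Q) ?_ continuous_subtype_val.continuousOn
      (fun _ h => h) fun _ _ => rfl
    rcases ht Q hQ with rfl | ⟨γ, hγ, rfl⟩
    · exact hasFilling_constMaps
    · exact hasFilling_orbit hadm.isClosed_group γ (hstab γ hγ)
  · have h : ∃ a : A, a.1 ∈ Q := ⟨y, hy⟩
    rw [dif_pos h]
    exact hFQ Q hQ y _ hy h.choose_spec
  · by_cases hconst : y.1 ∈ constMaps n X
    · exact ⟨_, Finset.mem_insert_self _ _, hconst⟩
    · refine ⟨MulAction.orbit G y.1, Finset.mem_insert_of_mem (hfin.mem_toFinset.2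
        ⟨y.1, ⟨⟨⟨y, hy, rfl⟩, ⟨y, hyc, rfl⟩⟩, hconst⟩, rfl⟩), MulAction.mem_orbit_self _⟩
  · refine (Finset.card_insert_le _ _).trans (Nat.succ_le_succ ?_)
    have h := hfin.encard_eq_coe_toFinset_card
    rw [numNonconstOrbits, h] at hm
    exact_mod_cast hm.le

end Main

theorem mainTheorem2 {X : Type*} [TopologicalSpace X] (hX : IsMetrizableANR X)
    {n : ℕ} (hn : 1 ≤ n) (G : Subgroup (OGroup n)) (A : Set (SphereSpace n X))
    (F : C(A, ℝ)) (φ : C(A, A)) (hadm : IsAdmissible G A F φ)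
    (hbdd : BddBelow (Set.range F)) :
    ((∀ B : Set A, IsClosed B →
        sphericalComplexity n X (Subtype.val '' B) ≤
          sphericalComplexity n X (Subtype.val '' (φ '' B))) →
      ∀ c : ℝ,
        (∀ γ ∈ (fixSet φ ∩ sublevelSet F c) \ constMaps n X, MulAction.stabilizer G γ = ⊥) →
        sphericalComplexity n X (sublevelSet F c) ≤
          numNonconstOrbits G (fixSet φ ∩ sublevelSet F c) + 1) ∧
    (φ.Homotopic (ContinuousMap.id A) → (F '' Function.fixedPoints φ).Finite →
      (∀ γ ∈ fixSet φ \ constMaps n X, MulAction.stabilizer G γ = ⊥) →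
      sphericalComplexity n X A ≤ numNonconstOrbits G (fixSet φ) + 1) := by
  have := hX.metrizableSpace_sphereSpace n
  refine ⟨fun hSC c hstab => ?_, fun hhom hfinite hstab => ?_⟩
  · rcases eq_or_ne (numNonconstOrbits G (fixSet φ ∩ sublevelSet F c)) ⊤ with htop | htop
    · rw [htop, top_add]
      exact le_top
    · obtain ⟨m, hm⟩ := ENat.ne_top_iff_exists.1 htop
      rw [← hm]
      refine (sphericalComplexity_image_le_iff {a : A | F a ≤ c} (m + 1)).2 ?_
      refine hadm.sphericalComplexity_sublevelSet_le hX hbdd (fun B hB k hk => ?_) c hstab hm.symm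
      rw [← sphericalComplexity_image_le_iff] at hk ⊢
      exact (hSC B hB).trans hk
  · rcases eq_or_ne (numNonconstOrbits G (fixSet φ)) ⊤ with htop | htop
    · rw [htop, top_add]
      exact le_top
    · obtain ⟨b, hb⟩ := hfinite.bddAbove
      -- The shift by `1` puts all fixed points strictly below the level, as the deformation
      -- requires.
      obtain ⟨g, hg, hgc⟩ := hadm.conditionD.exists_homotopic_le hhom.symm (c := b + 1)
        fun y hy => (hb (mem_image_of_mem F hy)).trans_lt (lt_add_one b)
      have hle : numNonconstOrbits G (fixSet φ ∩ sublevelSet F (b + 1)) ≤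
          numNonconstOrbits G (fixSet φ) :=
        encard_le_encard (image_mono (sdiff_subset_sdiff_left inter_subset_left))
      obtain ⟨m, hm⟩ := ENat.ne_top_iff_exists.1 (hle.trans_lt htop.lt_top).ne
      refine le_trans ?_ (add_le_add_left hle 1)
      rw [← hm]
      have key := hadm.sphericalComplexity_sublevelSet_le hX hbdd
        (fun B _ k hk => FillCover.of_image continuous_subtype_val hhom.symm hk) (b + 1)
        (fun γ hγ => hstab γ ⟨hγ.1.1, hγ.2⟩) hm.symm
      have huniv : FillCover (Subtype.val : A → SphereSpace n X) univ (m + 1) :=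
        FillCover.of_image continuous_subtype_val hg (key.mono (by
          rintro _ ⟨a, -, rfl⟩
          exact hgc a))
      have h := (sphericalComplexity_image_le_iff (univ : Set A) (m + 1)).2 huniv
      rwa [image_univ, Subtype.range_coe] at h
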